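/- **Setting.** Let $x_1,\dots,x_n\in\mathbb R^d$ with $\|x_i\|=1$ and $y_1,\dots,y_n\in\mathbb R$ with $|y_i|\le B$. Consider the two-layer ReLU network of width $m$ $$f(W,a,x)=\frac1{\sqrt m}\sum_{r=1}^m a_r\,\sigma(\langle w_r,x\rangle),\qquad \sigma(z)=\max(0,z),$$ with random initialization $w_r(0)\sim N(0,I_d)$, $a_r\sim\mathrm{Unif}\{-1,1\}$, all independent, and the loss $L(W)=\sum_{i=1}^n\frac12\big(f(W,a,x_i)-y_i\big)^2$. The vector $a$ is kept fixed and the first layer is trained by gradient descent with constant step size $\eta$, $$w_r(k+1)=w_r(k)-\eta\,\frac{\partial L(W(k))}{\partial w_r},\qquad \frac{\partial L(W)}{\partial w_r}=\frac{a_r}{\sqrt m}\sum_{i=1}^n\big(f(W,a,x_i)-y_i\big)\,\mathbb 1\{\langle w_r,x_i\rangle\ge0\}\,x_i .$$ Let $H^\infty\in\mathbb R^{n\times n}$ be the matrix $H^\infty_{ij}=\mathbb E_{w\sim N(0,I_d)}\big[\langle x_i,x_j\rangle\,\mathbb 1\{\langle w,x_i\rangle\ge0,\ \langle w,x_j\rangle\ge0\}\big]$,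 let $\|H^\infty\|$ be its largest eigenvalue and $\lambda_0$ its smallest eigenvalue. **Theorem (convergence rate of gradient descent with improved learning rate).** There is an absolute constant $c_2>0$, for every $B>0$ a constant $C_m=C_m(B)>0$, and for every $c_1>0$ a constant $C_T=C_T(B,c_1)>0$, such that the following holds for all $d,n,m$, all data as above with $\lambda_0>0$, and all $\delta,\varepsilon\in(0,1)$. If $$m\ \ge\ C_m\,\frac{n^6}{\lambda_0^4\,\delta^3}\qquad\text{and}\qquad \frac{c_1}{\|H^\infty\|}\ \le\ \eta\ \le\ \frac{c_2}{\|H^\infty\|},$$ then with probability at least $1-\delta$ over the random initialization, $L(W(T))\le\varepsilon$ for every number of iterations $$T\ \ge\ C_T\,\frac{\|H^\infty\|}{\lambda_0}\,\log\frac{2n}{\varepsilon\delta}.$$ In short: width $m=\Omega\big(n^6/(\lambda_0^4\delta^3)\big)$ and step size $\eta=\Theta(1/\|H^\infty\|)$ give loss at most $\varepsilon$ after $T=\widetilde O\big(\frac{\|H^\infty\|}{\lambda_0}\log\frac1\varepsilon\big)$ iterations, where $\widetilde O$ hides logarithms of $n$ and $1/\delta$. -/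

import Mathlib

open MeasureTheory ProbabilityTheory

noncomputable section

namespace TwoLayer

/-- The output `f(W, a, x) = m^{-1/2} ∑ r, a_r σ(⟨w_r, x⟩)` of a two-layer network of width `m`,
where `σ(z) = max(0, z)` is the ReLU. -/
def network {d m : ℕ} (W : Fin m → EuclideanSpace ℝ (Fin d)) (a : Fin m → ℝ)
    (x : EuclideanSpace ℝ (Fin d)) : ℝ :=
  1 / Real.sqrt m * ∑ r, a r * max 0 (inner ℝ (W r) x)

/-- The quadratic training loss `L(W) = ∑ i, (f(W, a, x_i) - y_i)² / 2`. -/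
def loss {d m n : ℕ} (x : Fin n → EuclideanSpace ℝ (Fin d)) (y : Fin n → ℝ)
    (a : Fin m → ℝ) (W : Fin m → EuclideanSpace ℝ (Fin d)) : ℝ :=
  ∑ i, 1 / 2 * (network W a (x i) - y i) ^ 2

/-- The gradient of the loss with respect to the weight vector `w_r`, with the usual convention
`σ'(z) = 𝟙{z ≥ 0}` for the derivative of the ReLU:
`∂L/∂w_r = (a_r / √m) ∑ i, (f(W, a, x_i) - y_i) 𝟙{⟨w_r, x_i⟩ ≥ 0} x_i`. -/
def lossGrad {d m n : ℕ} (x : Fin n → EuclideanSpace ℝ (Fin d)) (y : Fin n → ℝ)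
    (a : Fin m → ℝ) (W : Fin m → EuclideanSpace ℝ (Fin d)) (r : Fin m) :
    EuclideanSpace ℝ (Fin d) :=
  (a r / Real.sqrt m) •
    ∑ i, ((network W a (x i) - y i) * (if 0 ≤ inner ℝ (W r) (x i) then 1 else 0)) • x i

/-- The iterates `W(k)` of gradient descent with constant step size `η` on the first layer,
started at `W₀`; the second layer `a` stays fixed. -/
def gdIter {d m n : ℕ} (x : Fin n → EuclideanSpace ℝ (Fin d)) (y : Fin n → ℝ)
    (a : Fin m → ℝ) (η : ℝ) (W₀ : Fin m → EuclideanSpace ℝ (Fin d)) :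
    ℕ → Fin m → EuclideanSpace ℝ (Fin d)
  | 0 => W₀
  | k + 1 => fun r => gdIter x y a η W₀ k r - η • lossGrad x y a (gdIter x y a η W₀ k) r

/-- The law of the random initialization `(W(0), a)`: all `w_r(0) ∼ N(0, I)` and
all `a_r ∼ Unif{-1, 1}`, independently. -/
def initMeasure (d m : ℕ) :
    Measure ((Fin m → EuclideanSpace ℝ (Fin d)) × (Fin m → ℝ)) :=
  (Measure.pi fun _ : Fin m => stdGaussian (EuclideanSpace ℝ (Fin d))).prod
    (Measure.pi fun _ : Fin m => uniformOn ({-1, 1} : Set ℝ))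

/-- The limiting Gram matrix
`H^∞_{ij} = 𝔼_{w ∼ N(0, I)} [⟨x_i, x_j⟩ 𝟙{⟨w, x_i⟩ ≥ 0, ⟨w, x_j⟩ ≥ 0}]`. -/
def gramInf {d n : ℕ} (x : Fin n → EuclideanSpace ℝ (Fin d)) : Matrix (Fin n) (Fin n) ℝ :=
  Matrix.of fun i j =>
    ∫ w, inner ℝ (x i) (x j) * (if 0 ≤ inner ℝ w (x i) ∧ 0 ≤ inner ℝ w (x j) then 1 else 0)
      ∂(stdGaussian (EuclideanSpace ℝ (Fin d)))

/-- The largest eigenvalue of a real symmetric matrix of positive size. -/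
def maxEigenvalue {n : ℕ} (A : Matrix (Fin n) (Fin n) ℝ) : ℝ := sSup (spectrum ℝ A)

/-- The smallest eigenvalue of a real symmetric matrix of positive size. -/
def minEigenvalue {n : ℕ} (A : Matrix (Fin n) (Fin n) ℝ) : ℝ := sInf (spectrum ℝ A)

end TwoLayer

end

/-!
# Linear convergence of gradient descent with step size of order `1 / ‖H^∞‖`

Let `e(k)` be the vector of residuals after `k` steps and `H(W)` the Gram matrix `gram x W` of the
gradients of the network. If the ReLU were replaced by its linearization at `W(k)`, one step would
give `e(k + 1) = (1 - η H(W(k))) e(k)`. The linearization is exact for every neuron that does not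
change its activation, so a neuron contributes an error at `x_i` only if its initial preactivation
there is at most `R` in absolute value, where `R` bounds the movement of the weights
(`abs_residual_step_le`). The same neurons account for the difference `H(W(k)) - H(W(0))`
(`sqrt_sum_gram_sub_sq_le`). Comparing with `1 - η H^∞`, which contracts by `1 - η λ₀` as soon as
`η ‖H^∞‖ ≤ 1` (`norm_sub_smul_mulVec_le`), all perturbations together cost at most `η λ₀ / 2`, so
that `‖e(k + 1)‖ ≤ (1 - η λ₀ / 2) ‖e(k)‖`. Using this comparison instead of expanding `‖e(k + 1)‖²`
with a crude bound on the second-order term is what allows a step size of order `1 / ‖H^∞‖`.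

The argument closes by induction on `k` (`norm_residual_gdIter_le`): geometric decay of the
residuals bounds the movement of each neuron by `2 √n ‖e(0)‖ / (√m λ₀)`, which is at most `R` for
large `m`, and small movement in turn gives the next step of the decay.

Three random quantities have to be controlled at initialization, and for each a bound on its
expectation and Markov's inequality suffice: `‖e(0)‖²` is of order `n (1 + B²)` since the signs
decorrelate the neurons, `‖H(W(0)) - H^∞‖²` in Frobenius norm is of order `n² / m` by independence,
and the expected fraction of neurons near the activation boundary of `x_i` is at most `2 R` because
the Gaussian density is bounded.
-/

noncomputable section

namespace TwoLayer

open scoped Matrix ENNReal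

variable {d m n : ℕ}

/-! ### The dynamics of the residuals on a good initialization -/

/-- The vector of residuals `f(W, a, x_i) - y_i`, in Euclidean norm. -/
def residual (x : Fin n → EuclideanSpace ℝ (Fin d)) (y : Fin n → ℝ) (a : Fin m → ℝ)
    (W : Fin m → EuclideanSpace ℝ (Fin d)) : EuclideanSpace ℝ (Fin n) :=
  WithLp.toLp 2 fun i => network W a (x i) - y i

/-- The Gram matrix of the gradients of the network at the weights `W`, for signs `a_r = ±1`. -/
def gram (x : Fin n → EuclideanSpace ℝ (Fin d)) (W : Fin m → EuclideanSpace ℝ (Fin d)) :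
    Matrix (Fin n) (Fin n) ℝ :=
  Matrix.of fun i j => 1 / (m : ℝ) * ∑ r, inner ℝ (x i) (x j) *
    (if 0 ≤ inner ℝ (W r) (x i) ∧ 0 ≤ inner ℝ (W r) (x j) then 1 else 0)

/-- The fraction of neurons whose preactivation at `x` is at most `R` in absolute value: those
which can change their activation at the unit vector `x` when their weights move by at most `R`. -/
def nearFrac (R : ℝ) (W : Fin m → EuclideanSpace ℝ (Fin d)) (x : EuclideanSpace ℝ (Fin d)) : ℝ :=
  1 / (m : ℝ) * ∑ r, if |inner ℝ (W r) x| ≤ R then 1 else 0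

lemma nearFrac_nonneg (R : ℝ) (W : Fin m → EuclideanSpace ℝ (Fin d))
    (x : EuclideanSpace ℝ (Fin d)) : 0 ≤ nearFrac R W x := by
  unfold nearFrac
  exact mul_nonneg (by positivity) (Finset.sum_nonneg fun r _ => by split_ifs <;> norm_num)

lemma loss_eq (x : Fin n → EuclideanSpace ℝ (Fin d)) (y : Fin n → ℝ) (a : Fin m → ℝ)
    (W : Fin m → EuclideanSpace ℝ (Fin d)) :
    loss x y a W = 1 / 2 * ‖residual x y a W‖ ^ 2 := by
  simp [loss, residual, EuclideanSpace.real_norm_sq_eq, Finset.mul_sum]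

lemma norm_toLp_mulVec_le (A : Matrix (Fin n) (Fin n) ℝ) (v : EuclideanSpace ℝ (Fin n)) :
    ‖(WithLp.toLp 2 (A *ᵥ v.ofLp) : EuclideanSpace ℝ (Fin n))‖
      ≤ √(∑ i, ∑ j, A i j ^ 2) * ‖v‖ := by
  refine le_of_sq_le_sq ?_ (by positivity)
  rw [mul_pow, Real.sq_sqrt (by positivity), EuclideanSpace.real_norm_sq_eq,
    EuclideanSpace.real_norm_sq_eq, Finset.sum_mul]
  exact Finset.sum_le_sum fun i _ =>
    Finset.sum_mul_sq_le_sq_mul_sq Finset.univ (fun j => A i j) (fun j => v j)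

lemma norm_toLp_le {f : Fin n → ℝ} {C : ℝ} {s : Fin n → ℝ} (hs : ∀ i, 0 ≤ s i) (hC : 0 ≤ C)
    (h : ∀ i, |f i| ≤ C * s i) :
    ‖(WithLp.toLp 2 f : EuclideanSpace ℝ (Fin n))‖ ≤ C * ∑ i, s i := by
  have h0 : 0 ≤ ∑ i, s i := Finset.sum_nonneg fun i _ => hs i
  refine le_of_sq_le_sq ?_ (by positivity)
  rw [mul_pow, EuclideanSpace.real_norm_sq_eq]
  calc ∑ i, f i ^ 2 ≤ ∑ i, C ^ 2 * s i ^ 2 := Finset.sum_le_sum fun i _ => by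
        rw [← mul_pow]; exact sq_le_sq' (by linarith [neg_abs_le (f i), h i])
          ((le_abs_self _).trans (h i))
    _ = C ^ 2 * ∑ i, s i ^ 2 := by rw [Finset.mul_sum]
    _ ≤ _ := by gcongr; exact Finset.sum_sq_le_sq_sum_of_nonneg fun i _ => hs i

lemma sum_abs_le_sqrt_mul_norm (v : EuclideanSpace ℝ (Fin n)) : ∑ i, |v i| ≤ √n * ‖v‖ := by
  refine le_of_sq_le_sq ?_ (by positivity)
  rw [mul_pow, Real.sq_sqrt (by positivity), EuclideanSpace.real_norm_sq_eq]
  simpa using sq_sum_le_card_mul_sum_sq (s := Finset.univ) (f := fun i => |v i|)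

/-- A neuron with preactivation larger than `R` keeps its activation while its weights stay within
distance `R`. -/
lemma activation_iff {w w₀ x : EuclideanSpace ℝ (Fin d)} {R : ℝ} (hx : ‖x‖ = 1)
    (hw : ‖w - w₀‖ ≤ R) (h : R < |inner ℝ w₀ x|) :
    0 ≤ inner ℝ w x ↔ 0 ≤ inner ℝ w₀ x := by
  have h1 : |inner ℝ w x - inner ℝ w₀ x| ≤ R := by
    rw [← inner_sub_left]
    exact (abs_real_inner_le_norm _ _).trans (by simpa [hx] using hw)
  rw [abs_le] at h1
  rcases lt_abs.1 h with h | h <;> constructor <;> intro h' <;> linarith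

lemma abs_inner_le_one {u v : EuclideanSpace ℝ (Fin d)} (hu : ‖u‖ = 1) (hv : ‖v‖ = 1) :
    |inner ℝ u v| ≤ 1 := by
  simpa [hu, hv] using abs_real_inner_le_norm u v

lemma abs_gram_sub_le {x : Fin n → EuclideanSpace ℝ (Fin d)} (hx : ∀ i, ‖x i‖ = 1)
    {W W₀ : Fin m → EuclideanSpace ℝ (Fin d)} {R : ℝ} (hW : ∀ r, ‖W r - W₀ r‖ ≤ R)
    (i j : Fin n) :
    |gram x W i j - gram x W₀ i j| ≤ nearFrac R W₀ (x i) + nearFrac R W₀ (x j) := by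
  simp only [gram, nearFrac, Matrix.of_apply]
  rw [← mul_sub, ← mul_add, ← Finset.sum_sub_distrib, ← Finset.sum_add_distrib, abs_mul,
    abs_of_nonneg (by positivity : (0 : ℝ) ≤ 1 / m)]
  gcongr
  refine (Finset.abs_sum_le_sum_abs _ _).trans (Finset.sum_le_sum fun r _ => ?_)
  rw [← mul_sub, abs_mul]
  by_cases h1 : R < |inner ℝ (W₀ r) (x i)|
  · by_cases h2 : R < |inner ℝ (W₀ r) (x j)|
    · simp only [activation_iff (hx i) (hW r) h1, activation_iff (hx j) (hW r) h2]
      simp [h1.not_ge, h2.not_ge]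
    · refine (mul_le_one₀ (abs_inner_le_one (hx i) (hx j)) (abs_nonneg _) ?_).trans ?_
      · split_ifs <;> simp
      · simp [not_lt.1 h2]; split_ifs <;> norm_num
  · refine (mul_le_one₀ (abs_inner_le_one (hx i) (hx j)) (abs_nonneg _) ?_).trans ?_
    · split_ifs <;> simp
    · simp [not_lt.1 h1]; split_ifs <;> norm_num

/-- While the weights stay within distance `R` of the initialization, the Gram matrix stays close
to its initial value in Frobenius norm. -/
lemma sqrt_sum_gram_sub_sq_le {x : Fin n → EuclideanSpace ℝ (Fin d)} (hx : ∀ i, ‖x i‖ = 1)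
    {W W₀ : Fin m → EuclideanSpace ℝ (Fin d)} {R : ℝ} (hW : ∀ r, ‖W r - W₀ r‖ ≤ R) :
    √(∑ i, ∑ j, (gram x W - gram x W₀) i j ^ 2) ≤ 2 * √n * ∑ i, nearFrac R W₀ (x i) := by
  set s : Fin n → ℝ := fun i => nearFrac R W₀ (x i) with hs
  have hs0 : ∀ i, 0 ≤ s i := fun i => nearFrac_nonneg _ _ _
  have hS : 0 ≤ ∑ i, s i := Finset.sum_nonneg fun i _ => hs0 i
  refine Real.sqrt_le_iff.2 ⟨by positivity, ?_⟩
  calc ∑ i, ∑ j, (gram x W - gram x W₀) i j ^ 2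
      ≤ ∑ i, ∑ j, (2 * s i ^ 2 + 2 * s j ^ 2) := by
        refine Finset.sum_le_sum fun i _ => Finset.sum_le_sum fun j _ => ?_
        have h := abs_gram_sub_le hx hW i j
        have h' : (gram x W i j - gram x W₀ i j) ^ 2 ≤ (s i + s j) ^ 2 :=
          sq_le_sq' (by linarith [neg_abs_le (gram x W i j - gram x W₀ i j)])
            ((le_abs_self _).trans h)
        rw [Matrix.sub_apply]
        nlinarith [sq_nonneg (s i - s j)]
    _ = 4 * n * ∑ i, s i ^ 2 := by
        simp only [Finset.sum_add_distrib, Finset.sum_const, Finset.card_univ, Fintype.card_fin,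
          nsmul_eq_mul, ← Finset.mul_sum]
        ring
    _ ≤ 4 * n * (∑ i, s i) ^ 2 := by
        gcongr; exact Finset.sum_sq_le_sq_sum_of_nonneg fun i _ => hs0 i
    _ = _ := by rw [mul_pow, mul_pow, Real.sq_sqrt (by positivity)]; ring

lemma norm_lossGrad_le {x : Fin n → EuclideanSpace ℝ (Fin d)} (hx : ∀ i, ‖x i‖ = 1)
    (y : Fin n → ℝ) {a : Fin m → ℝ} (ha : ∀ r, |a r| = 1)
    (W : Fin m → EuclideanSpace ℝ (Fin d)) (r : Fin m) :
    ‖lossGrad x y a W r‖ ≤ √n / √m * ‖residual x y a W‖ := by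
  have h : ‖∑ i, ((network W a (x i) - y i) *
      (if 0 ≤ inner ℝ (W r) (x i) then 1 else 0)) • x i‖ ≤ √n * ‖residual x y a W‖ := by
    refine le_trans ?_ (sum_abs_le_sqrt_mul_norm _)
    refine (norm_sum_le _ _).trans (Finset.sum_le_sum fun i _ => ?_)
    rw [norm_smul, hx, mul_one, Real.norm_eq_abs, abs_mul]
    exact mul_le_of_le_one_right (abs_nonneg _) (by split_ifs <;> simp)
  rw [lossGrad, norm_smul, Real.norm_eq_abs, abs_div, ha, abs_of_nonneg (Real.sqrt_nonneg _)]
  calc _ ≤ 1 / √m * (√n * ‖residual x y a W‖) := by gcongr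
    _ = _ := by ring

/-- The error of the linearization of the ReLU at `s`, with derivative `1` at `0`. It vanishes if the
activation does not change, see `relu_sub_eq`. -/
lemma abs_relu_sub_le (s t : ℝ) :
    |max 0 t - max 0 s - (if 0 ≤ s then 1 else 0) * (t - s)| ≤ |t - s| := by
  split_ifs with h
  · rw [max_eq_right h]
    rcases le_total 0 t with h' | h'
    · simp [h']
    · rw [max_eq_left h', abs_le]
      constructor <;> rw [abs_of_nonpos (by linarith)] <;> linarith
  · rw [max_eq_left (not_le.1 h).le]
    rcases le_total 0 t with h' | h'
    · rw [max_eq_right h', abs_le]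
      constructor <;> rw [abs_of_nonneg (by linarith)] <;> linarith
    · simp [h']

lemma relu_sub_eq {s t : ℝ} (h : 0 ≤ t ↔ 0 ≤ s) :
    max 0 t - max 0 s - (if 0 ≤ s then 1 else 0) * (t - s) = 0 := by
  split_ifs with hs
  · rw [max_eq_right hs, max_eq_right (h.2 hs)]; ring
  · rw [max_eq_left (not_le.1 hs).le, max_eq_left (not_le.1 (mt h.1 hs)).le]; ring

/-- One step of gradient descent acts on the residuals as `1 - η H`, up to an error which comes
from the neurons that may change their activation. -/
lemma abs_residual_step_le {x : Fin n → EuclideanSpace ℝ (Fin d)} (hx : ∀ i, ‖x i‖ = 1)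
    (y : Fin n → ℝ) {a : Fin m → ℝ} (ha : ∀ r, |a r| = 1) {η R : ℝ} (hη : 0 ≤ η)
    {W W' W₀ : Fin m → EuclideanSpace ℝ (Fin d)} (hW : ∀ r, ‖W r - W₀ r‖ ≤ R)
    (hW' : ∀ r, ‖W' r - W₀ r‖ ≤ R) (hstep : ∀ r, W' r = W r - η • lossGrad x y a W r)
    (i : Fin n) :
    |residual x y a W' i - (residual x y a W i
        - η * (gram x W *ᵥ (residual x y a W).ofLp) i)|
      ≤ η * √n * ‖residual x y a W‖ * nearFrac R W₀ (x i) := by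
  set e := residual x y a W with he
  have hinner : ∀ r, inner ℝ (W' r) (x i) - inner ℝ (W r) (x i) =
      - (η * (a r / √m) * ∑ j, e j * (if 0 ≤ inner ℝ (W r) (x j) then 1 else 0)
          * inner ℝ (x i) (x j)) := by
    intro r
    rw [hstep, inner_sub_left, inner_smul_left, lossGrad, inner_smul_left, sum_inner]
    simp only [inner_smul_left, RCLike.conj_to_real]
    rw [sub_sub_cancel_left]
    simp only [real_inner_comm (x i)]
    rw [mul_assoc]; rfl
  have hlin : η * (gram x W *ᵥ e.ofLp) i = - (1 / √m * ∑ r, a r *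
      ((if 0 ≤ inner ℝ (W r) (x i) then 1 else 0) *
        (inner ℝ (W' r) (x i) - inner ℝ (W r) (x i)))) := by
    simp only [hinner, Matrix.mulVec, dotProduct, gram, Matrix.of_apply, Finset.mul_sum,
      Finset.sum_mul, ← Finset.sum_neg_distrib]
    rw [Finset.sum_comm]
    refine Finset.sum_congr rfl fun r _ => Finset.sum_congr rfl fun j _ => ?_
    have h1 : a r * a r = 1 := by rw [← abs_mul_abs_self, ha]; norm_num
    have h2 : (1 : ℝ) / m = 1 / √m * (1 / √m) := by
      rw [div_mul_div_comm, Real.mul_self_sqrt (by positivity), mul_one]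
    rw [h2]
    split_ifs <;> simp_all
    linear_combination (- η * (√m)⁻¹ * (√m)⁻¹ * inner ℝ (x i) (x j) * e j) * h1
  have hdiff : residual x y a W' i - (e i - η * (gram x W *ᵥ e.ofLp) i) =
      1 / √m * ∑ r, a r * (max 0 (inner ℝ (W' r) (x i)) - max 0 (inner ℝ (W r) (x i)) -
        (if 0 ≤ inner ℝ (W r) (x i) then 1 else 0) *
          (inner ℝ (W' r) (x i) - inner ℝ (W r) (x i))) := by
    rw [hlin]
    simp only [he, residual, network, mul_sub, Finset.sum_sub_distrib]
    ring
  rw [hdiff, abs_mul, abs_of_nonneg (by positivity : (0 : ℝ) ≤ 1 / √m), nearFrac]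
  have hterm : ∀ r, |a r * (max 0 (inner ℝ (W' r) (x i)) - max 0 (inner ℝ (W r) (x i)) -
        (if 0 ≤ inner ℝ (W r) (x i) then 1 else 0) *
          (inner ℝ (W' r) (x i) - inner ℝ (W r) (x i)))|
      ≤ η * (√n / √m * ‖e‖) * (if |inner ℝ (W₀ r) (x i)| ≤ R then 1 else 0) := by
    intro r
    rw [abs_mul, ha, one_mul]
    by_cases h : |inner ℝ (W₀ r) (x i)| ≤ R
    · rw [if_pos h]
      refine (abs_relu_sub_le _ _).trans ?_
      rw [← inner_sub_left, mul_one]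
      refine (abs_real_inner_le_norm _ _).trans ?_
      rw [hx, mul_one, hstep, sub_sub_cancel_left, norm_neg, norm_smul, Real.norm_eq_abs,
        abs_of_nonneg hη]
      gcongr
      exact norm_lossGrad_le hx y ha W r
    · rw [if_neg h]
      rw [not_le] at h
      rw [relu_sub_eq ((activation_iff (hx i) (hW' r) h).trans
        (activation_iff (hx i) (hW r) h).symm)]
      simp
  calc _ ≤ 1 / √m * ∑ r, η * (√n / √m * ‖e‖) *
        (if |inner ℝ (W₀ r) (x i)| ≤ R then 1 else 0) := by
        gcongr
        exact (Finset.abs_sum_le_sum_abs _ _).trans (Finset.sum_le_sum fun r _ => hterm r)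
    _ = _ := by
        have h2 : (1 : ℝ) / m = 1 / √m * (1 / √m) := by
          rw [div_mul_div_comm, Real.mul_self_sqrt (by positivity), mul_one]
        rw [← Finset.mul_sum, h2]; ring

/-- Linear convergence on the event where the random quantities are controlled. Here `H` is any
matrix for which `1 - η H` contracts by `1 - η lam`. -/
theorem norm_residual_gdIter_le {x : Fin n → EuclideanSpace ℝ (Fin d)} (hx : ∀ i, ‖x i‖ = 1)
    (y : Fin n → ℝ) {a : Fin m → ℝ} (ha : ∀ r, |a r| = 1) {η R lam E : ℝ} (hη : 0 ≤ η)
    (hlam : 0 < lam) (hηlam : η * lam ≤ 1) {W₀ : Fin m → EuclideanSpace ℝ (Fin d)}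
    {H : Matrix (Fin n) (Fin n) ℝ}
    (hH : ∀ v : EuclideanSpace ℝ (Fin n),
      ‖v - η • (WithLp.toLp 2 (H *ᵥ v.ofLp) : EuclideanSpace ℝ (Fin n))‖ ≤ (1 - η * lam) * ‖v‖)
    (hgram : √(∑ i, ∑ j, (gram x W₀ - H) i j ^ 2) ≤ lam / 8)
    (hnear : √n * ∑ i, nearFrac R W₀ (x i) ≤ lam / 16)
    (hE : ‖residual x y a W₀‖ ≤ E)
    (hR : 2 * √n / (√m * lam) * E ≤ R) (k : ℕ) :
    ‖residual x y a (gdIter x y a η W₀ k)‖ ≤ (1 - η * lam / 2) ^ k * E := by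
  have hρ : 0 ≤ 1 - η * lam / 2 := by linarith
  have hρ1 : 1 - η * lam / 2 ≤ 1 := by nlinarith
  have hE0 : 0 ≤ E := (norm_nonneg _).trans hE
  have hstay : ∀ (k : ℕ) (w w₀ : EuclideanSpace ℝ (Fin d)),
      ‖w - w₀‖ ≤ 2 * √n / (√m * lam) * E * (1 - (1 - η * lam / 2) ^ k) → ‖w - w₀‖ ≤ R := by
    intro k w w₀ h
    refine h.trans (le_trans ?_ hR)
    exact mul_le_of_le_one_right (by positivity) (by linarith [pow_nonneg hρ k])
  suffices h : ‖residual x y a (gdIter x y a η W₀ k)‖ ≤ (1 - η * lam / 2) ^ k * E ∧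
      ∀ r, ‖gdIter x y a η W₀ k r - W₀ r‖ ≤
        2 * √n / (√m * lam) * E * (1 - (1 - η * lam / 2) ^ k) from h.1
  induction k with
  | zero => simpa [gdIter] using hE
  | succ k ih =>
    obtain ⟨ih1, ih2⟩ := ih
    set W := gdIter x y a η W₀ k with hWdef
    set W' := gdIter x y a η W₀ (k + 1) with hWdef'
    have hstep : ∀ r, W' r = W r - η • lossGrad x y a W r := fun r => rfl
    have hmove : ∀ r, ‖W' r - W₀ r‖ ≤
        2 * √n / (√m * lam) * E * (1 - (1 - η * lam / 2) ^ (k + 1)) := by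
      intro r
      calc ‖W' r - W₀ r‖ = ‖(W r - W₀ r) - η • lossGrad x y a W r‖ := by
            rw [hstep]; congr 1; abel
        _ ≤ ‖W r - W₀ r‖ + η * ‖lossGrad x y a W r‖ := by
            refine (norm_sub_le _ _).trans ?_
            rw [norm_smul, Real.norm_eq_abs, abs_of_nonneg hη]
        _ ≤ 2 * √n / (√m * lam) * E * (1 - (1 - η * lam / 2) ^ k) +
              η * (√n / √m * ((1 - η * lam / 2) ^ k * E)) := by
            gcongr
            · exact ih2 r
            · refine (norm_lossGrad_le hx y ha W r).trans ?_
              gcongr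
        _ = _ := by
            rw [pow_succ, mul_comm √(m : ℝ) lam, ← div_div]
            field_simp
            ring
    refine ⟨?_, hmove⟩
    have hWR : ∀ r, ‖W r - W₀ r‖ ≤ R := fun r => hstay _ _ _ (ih2 r)
    have hWR' : ∀ r, ‖W' r - W₀ r‖ ≤ R := fun r => hstay _ _ _ (hmove r)
    set e := residual x y a W with he
    set e' := residual x y a W' with he'
    set S := ∑ i, nearFrac R W₀ (x i) with hS
    have herr : ‖e' - (e - η • (WithLp.toLp 2 (gram x W *ᵥ e.ofLp) :
        EuclideanSpace ℝ (Fin n)))‖ ≤ η * √n * ‖e‖ * S :=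
      norm_toLp_le (fun i => nearFrac_nonneg _ _ _) (by positivity)
        (abs_residual_step_le hx y ha hη hWR hWR' hstep)
    have h1 := norm_toLp_mulVec_le (gram x W - gram x W₀) e
    have h2 := norm_toLp_mulVec_le (gram x W₀ - H) e
    have h3 := sqrt_sum_gram_sub_sq_le hx hWR
    have hdecomp : e' = (e' - (e - η • (WithLp.toLp 2 (gram x W *ᵥ e.ofLp) :
        EuclideanSpace ℝ (Fin n)))) + (e - η • (WithLp.toLp 2 (H *ᵥ e.ofLp) :
        EuclideanSpace ℝ (Fin n))) - η • (WithLp.toLp 2 ((gram x W - gram x W₀) *ᵥ e.ofLp) :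
        EuclideanSpace ℝ (Fin n)) - η • (WithLp.toLp 2 ((gram x W₀ - H) *ᵥ e.ofLp) :
        EuclideanSpace ℝ (Fin n)) := by
      rw [Matrix.sub_mulVec, Matrix.sub_mulVec, WithLp.toLp_sub, WithLp.toLp_sub, smul_sub,
        smul_sub]
      abel
    have hnorm : ‖e'‖ ≤ η * √n * ‖e‖ * S + (1 - η * lam) * ‖e‖ +
        η * (lam / 8 * ‖e‖) + η * (lam / 8 * ‖e‖) := by
      rw [hdecomp]
      refine (norm_sub_le _ _).trans (add_le_add ((norm_sub_le _ _).trans (add_le_add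
        ((norm_add_le _ _).trans (add_le_add herr (hH e))) ?_)) ?_)
      · rw [norm_smul, Real.norm_eq_abs, abs_of_nonneg hη]
        gcongr
        refine h1.trans ?_
        gcongr
        linarith
      · rw [norm_smul, Real.norm_eq_abs, abs_of_nonneg hη]
        gcongr
        exact h2.trans (by gcongr)
    have h4 : η * √n * ‖e‖ * S ≤ η * ‖e‖ * (lam / 16) := by
      calc _ = η * ‖e‖ * (√n * S) := by ring
        _ ≤ _ := by gcongr
    calc ‖e'‖ ≤ (1 - η * lam / 2) * ‖e‖ := by
          have : 0 ≤ η * ‖e‖ * lam := by positivity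
          nlinarith
      _ ≤ (1 - η * lam / 2) * ((1 - η * lam / 2) ^ k * E) := by gcongr
      _ = _ := by ring

/-! ### Eigenvalues of symmetric matrices -/

lemma minEigenvalue_le {A : Matrix (Fin n) (Fin n) ℝ} (hA : A.IsHermitian) (i : Fin n) :
    minEigenvalue A ≤ hA.eigenvalues i := by
  rw [minEigenvalue, hA.spectrum_real_eq_range_eigenvalues]
  exact csInf_le (Set.finite_range _).bddBelow ⟨i, rfl⟩

lemma le_maxEigenvalue {A : Matrix (Fin n) (Fin n) ℝ} (hA : A.IsHermitian) (i : Fin n) :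
    hA.eigenvalues i ≤ maxEigenvalue A := by
  rw [maxEigenvalue, hA.spectrum_real_eq_range_eigenvalues]
  exact le_csSup (Set.finite_range _).bddAbove ⟨i, rfl⟩

/-- The smallest eigenvalue is at most the average of the diagonal. -/
lemma card_mul_minEigenvalue_le_trace {A : Matrix (Fin n) (Fin n) ℝ} (hA : A.IsHermitian) :
    n * minEigenvalue A ≤ A.trace := by
  rw [hA.trace_eq_sum_eigenvalues]
  calc n * minEigenvalue A = ∑ _i : Fin n, minEigenvalue A := by simp
    _ ≤ _ := Finset.sum_le_sum fun i _ => minEigenvalue_le hA i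

/-- For `0 ≤ η ≤ 1 / ‖A‖` the matrix `1 - η A` contracts by `1 - η λ₀`. This is where a step size of
order `1 / ‖A‖` is enough. -/
lemma norm_sub_smul_mulVec_le {A : Matrix (Fin n) (Fin n) ℝ} (hA : A.IsHermitian) {η : ℝ}
    (hη : 0 ≤ η) (hmax : η * maxEigenvalue A ≤ 1) (v : EuclideanSpace ℝ (Fin n)) :
    ‖v - η • (WithLp.toLp 2 (A *ᵥ v.ofLp) : EuclideanSpace ℝ (Fin n))‖
      ≤ (1 - η * minEigenvalue A) * ‖v‖ := by
  rcases isEmpty_or_nonempty (Fin n) with h0 | ⟨⟨i₀⟩⟩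
  · simp [Subsingleton.elim v 0]
  have hle : ∀ i, 0 ≤ 1 - η * hA.eigenvalues i ∧
      1 - η * hA.eigenvalues i ≤ 1 - η * minEigenvalue A := fun i =>
    ⟨by linarith [mul_le_mul_of_nonneg_left (le_maxEigenvalue hA i) hη],
      by linarith [mul_le_mul_of_nonneg_left (minEigenvalue_le hA i) hη]⟩
  have h1 : 0 ≤ 1 - η * minEigenvalue A := (hle i₀).1.trans (hle i₀).2
  set b := hA.eigenvectorBasis
  have hcoef : ∀ i, inner ℝ (b i) (v - η • (WithLp.toLp 2 (A *ᵥ v.ofLp) :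
      EuclideanSpace ℝ (Fin n))) = (1 - η * hA.eigenvalues i) * inner ℝ (b i) v := by
    intro i
    have h2 : inner ℝ (b i) (WithLp.toLp 2 (A *ᵥ v.ofLp) : EuclideanSpace ℝ (Fin n))
        = hA.eigenvalues i * inner ℝ (b i) v := by
      have hT : Aᵀ = A := by simpa [Matrix.IsHermitian] using hA
      have h3 := hA.mulVec_eigenvectorBasis i
      simp only [EuclideanSpace.inner_eq_star_dotProduct, star_trivial]
      rw [dotProduct_comm, Matrix.dotProduct_mulVec, ← Matrix.mulVec_transpose, hT, h3,
        smul_dotProduct, smul_eq_mul, dotProduct_comm]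
    rw [inner_sub_right, inner_smul_right, h2]
    ring
  refine le_of_sq_le_sq ?_ (by positivity)
  rw [mul_pow, ← b.sum_sq_inner_right, ← b.sum_sq_inner_right v, Finset.mul_sum]
  refine Finset.sum_le_sum fun i _ => ?_
  rw [hcoef, mul_pow]
  gcongr
  · exact (hle i).1
  · exact minEigenvalue_le hA i

lemma isHermitian_gramInf (x : Fin n → EuclideanSpace ℝ (Fin d)) : (gramInf x).IsHermitian := by
  ext i j
  simp [gramInf, real_inner_comm, and_comm]

/-! ### Moments of a single neuron and of independent sums -/

lemma map_inner_stdGaussian {x : EuclideanSpace ℝ (Fin d)} (hx : ‖x‖ = 1) :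
    (stdGaussian (EuclideanSpace ℝ (Fin d))).map (fun w => inner ℝ w x) = gaussianReal 0 1 := by
  have h := IsGaussian.map_eq_gaussianReal (μ := stdGaussian (EuclideanSpace ℝ (Fin d)))
    (innerSL ℝ x)
  rw [integral_strongDual_stdGaussian, variance_dual_stdGaussian] at h
  simpa [hx, real_inner_comm] using h

/-- Anticoncentration of a Gaussian weight vector. -/
lemma stdGaussian_abs_inner_le {x : EuclideanSpace ℝ (Fin d)} (hx : ‖x‖ = 1) (R : ℝ) :
    stdGaussian (EuclideanSpace ℝ (Fin d)) {w | |inner ℝ w x| ≤ R} ≤ ENNReal.ofReal (2 * R) := by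
  have h1 : stdGaussian (EuclideanSpace ℝ (Fin d)) {w | |inner ℝ w x| ≤ R}
      = gaussianReal 0 1 (Set.Icc (-R) R) := by
    rw [← map_inner_stdGaussian hx, Measure.map_apply (by fun_prop) measurableSet_Icc]
    congr 1; ext w; simp [abs_le]
  rw [h1, gaussianReal_apply _ one_ne_zero]
  calc ∫⁻ z in Set.Icc (-R) R, gaussianPDF 0 1 z ≤ ∫⁻ z in Set.Icc (-R) R, 1 := by
        refine lintegral_mono fun z => ?_
        rw [gaussianPDF, gaussianPDFReal]
        refine ENNReal.ofReal_le_one.2 (mul_le_one₀ (inv_le_one_of_one_le₀ ?_) (by positivity) ?_)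
        · rw [Real.one_le_sqrt]
          simp; linarith [Real.pi_gt_three]
        · rw [Real.exp_le_one_iff]
          have := sq_nonneg z
          simp; linarith
    _ = ENNReal.ofReal (2 * R) := by
        rw [setLIntegral_one, Real.volume_Icc]; congr 1; ring

lemma lintegral_sq_relu_le {x : EuclideanSpace ℝ (Fin d)} (hx : ‖x‖ = 1) :
    ∫⁻ w, ENNReal.ofReal (max 0 (inner ℝ w x) ^ 2) ∂(stdGaussian (EuclideanSpace ℝ (Fin d)))
      ≤ 1 := by
  have h1 : ∫⁻ z, ENNReal.ofReal (z ^ 2) ∂(gaussianReal 0 1) = 1 := by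
    have h := variance_id_gaussianReal (μ := 0) (v := 1)
    have hi : Integrable (fun z : ℝ => z ^ 2) (gaussianReal 0 1) :=
      (IsGaussian.memLp_two_id (μ := gaussianReal 0 1)).integrable_sq
    rw [variance_eq_integral (by fun_prop)] at h
    simp at h
    rw [← ofReal_integral_eq_lintegral_ofReal hi (by filter_upwards with z; positivity), h]
    simp
  rw [← h1, ← map_inner_stdGaussian hx, lintegral_map (by fun_prop) (by fun_prop)]
  refine lintegral_mono fun w => ENNReal.ofReal_le_ofReal ?_
  rw [← sq_abs (inner ℝ w x)]
  gcongr
  exact max_le (abs_nonneg _) (le_abs_self _)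

instance : IsProbabilityMeasure (uniformOn ({-1, 1} : Set ℝ)) :=
  isProbabilityMeasure_uniformOn (by simp) (by simp)

lemma ae_abs_eq_one_uniformOn : ∀ᵐ s ∂(uniformOn ({-1, 1} : Set ℝ)), |s| = 1 := by
  have h : ∀ᵐ s ∂(uniformOn ({-1, 1} : Set ℝ)), s ∈ ({-1, 1} : Set ℝ) :=
    ae_cond_mem (by measurability)
  filter_upwards [h] with s hs
  rcases hs with rfl | rfl <;> simp

lemma integral_id_uniformOn : ∫ s, s ∂(uniformOn ({-1, 1} : Set ℝ)) = 0 := by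
  rw [uniformOn, ProbabilityTheory.cond, integral_smul_measure]
  have hi : IntegrableOn (fun s : ℝ => s) (({-1, 1} : Finset ℝ) : Set ℝ) Measure.count := by
    rw [Finset.coe_pair, Set.insert_eq, integrableOn_union]
    simp
  have : ∫ s in ({-1, 1} : Set ℝ), s ∂Measure.count = 0 := by
    have h := setIntegral_finset ({-1, 1} : Finset ℝ) hi
    rw [Finset.sum_pair (by norm_num)] at h
    simpa [Measure.real] using h
  rw [this, smul_zero]

/-- Independent centered variables are orthogonal, so the second moment of their sum is the sum of
their second moments. The variables here are bounded by the constants `c r`. -/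
lemma lintegral_sq_sum_pi_le {Ω : Type*} [MeasurableSpace Ω] (μ : Measure Ω)
    [IsProbabilityMeasure μ] {X : Fin m → Ω → ℝ} {c : Fin m → ℝ}
    (hX : ∀ r, AEStronglyMeasurable (X r) μ) (hb : ∀ r, ∀ᵐ w ∂μ, |X r w| ≤ c r)
    (h0 : ∀ r, ∫ w, X r w ∂μ = 0) :
    ∫⁻ ω, ENNReal.ofReal ((∑ r, X r (ω r)) ^ 2) ∂(Measure.pi fun _ : Fin m => μ)
      ≤ ENNReal.ofReal (∑ r, c r ^ 2) := by
  have hL : ∀ r, MemLp (X r) 2 μ := fun r => MemLp.of_bound (hX r) (c r) (hb r)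
  have hL' : ∀ r, MemLp (fun ω : Fin m → Ω => X r (ω r)) 2 (Measure.pi fun _ : Fin m => μ) :=
    fun r => (hL r).comp_measurePreserving (measurePreserving_eval _ r)
  have hsum : MemLp (∑ r, fun ω : Fin m → Ω => X r (ω r)) 2 (Measure.pi fun _ : Fin m => μ) :=
    memLp_finsetSum' _ fun r _ => hL' r
  have hmean : ∫ ω, (∑ r, fun ω : Fin m → Ω => X r (ω r)) ω ∂(Measure.pi fun _ : Fin m => μ)
      = 0 := by
    simp only [Finset.sum_apply]
    rw [integral_finsetSum _ fun r _ => (hL' r).integrable (by norm_num)]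
    refine Finset.sum_eq_zero fun r _ => ?_
    rw [integral_comp_eval (μ := fun _ : Fin m => μ) (i := r) (hX r), h0]
  have hvar := variance_sum_pi (μ := fun _ : Fin m => μ) hL
  rw [variance_of_integral_eq_zero hsum.aemeasurable hmean] at hvar
  rw [← ofReal_integral_eq_lintegral_ofReal
    (by simpa using hsum.integrable_sq) (by filter_upwards with z; positivity)]
  refine ENNReal.ofReal_le_ofReal ?_
  simp only [Finset.sum_apply] at hvar
  rw [hvar]
  refine Finset.sum_le_sum fun r _ => ?_
  rw [variance_of_integral_eq_zero (hX r).aemeasurable (h0 r)]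
  calc ∫ w, X r w ^ 2 ∂μ ≤ ∫ w, c r ^ 2 ∂μ := by
        refine integral_mono_ae (hL r).integrable_sq (integrable_const _) ?_
        filter_upwards [hb r] with w hw
        exact sq_le_sq' (by linarith [neg_abs_le (X r w)]) ((le_abs_self _).trans hw)
    _ = c r ^ 2 := by simp

/-! ### The random initialization -/

instance : IsProbabilityMeasure (initMeasure d m) := by
  unfold initMeasure; infer_instance

lemma ae_abs_sign_eq_one : ∀ᵐ ω ∂(initMeasure d m), ∀ r, |ω.2 r| = 1 := by
  rw [initMeasure, ae_all_iff]
  intro r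
  have h : Measure.QuasiMeasurePreserving (fun ω : (Fin m → EuclideanSpace ℝ (Fin d)) ×
      (Fin m → ℝ) => ω.2 r) ((Measure.pi fun _ : Fin m =>
        stdGaussian (EuclideanSpace ℝ (Fin d))).prod
        (Measure.pi fun _ : Fin m => uniformOn ({-1, 1} : Set ℝ)))
      (uniformOn ({-1, 1} : Set ℝ)) :=
    ((measurePreserving_eval (fun _ : Fin m => uniformOn ({-1, 1} : Set ℝ)) r).comp
      measurePreserving_snd).quasiMeasurePreserving
  exact h.ae ae_abs_eq_one_uniformOn

@[fun_prop]
lemma measurable_network (x : EuclideanSpace ℝ (Fin d)) :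
    Measurable fun ω : (Fin m → EuclideanSpace ℝ (Fin d)) × (Fin m → ℝ) =>
      network ω.1 ω.2 x := by
  unfold network
  fun_prop

lemma measurable_coactivation (x x' : EuclideanSpace ℝ (Fin d)) :
    Measurable fun w : EuclideanSpace ℝ (Fin d) =>
      if 0 ≤ inner ℝ w x ∧ 0 ≤ inner ℝ w x' then (1 : ℝ) else 0 := by
  have h : ∀ z : EuclideanSpace ℝ (Fin d),
      MeasurableSet {w : EuclideanSpace ℝ (Fin d) | 0 ≤ inner ℝ w z} := fun z =>
    measurableSet_le measurable_const (by fun_prop)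
  exact Measurable.ite ((h x).inter (h x')) measurable_const measurable_const

lemma measurable_gram (x : Fin n → EuclideanSpace ℝ (Fin d)) (i j : Fin n) :
    Measurable fun W : Fin m → EuclideanSpace ℝ (Fin d) => gram x W i j := by
  unfold gram
  simp only [Matrix.of_apply]
  exact (Finset.measurable_sum _ fun r _ => ((measurable_coactivation (x i) (x j)).comp
    (measurable_pi_apply r)).const_mul _).const_mul _

lemma measurable_nearFrac (R : ℝ) (x : EuclideanSpace ℝ (Fin d)) :
    Measurable fun W : Fin m → EuclideanSpace ℝ (Fin d) => nearFrac R W x := by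
  unfold nearFrac
  refine Measurable.const_mul (Finset.measurable_sum _ fun r _ => ?_) _
  refine Measurable.ite ?_ measurable_const measurable_const
  exact measurableSet_le (by fun_prop) measurable_const

/-- The second moment of the network at initialization. Given the weights, the signs make the terms
of the network uncorrelated. -/
lemma lintegral_sq_network_le {x : EuclideanSpace ℝ (Fin d)} (hx : ‖x‖ = 1) :
    ∫⁻ ω, ENNReal.ofReal (network ω.1 ω.2 x ^ 2) ∂(initMeasure d m) ≤ 1 := by
  rw [initMeasure, lintegral_prod _ (by fun_prop)]
  have h1 : ∀ W : Fin m → EuclideanSpace ℝ (Fin d),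
      ∫⁻ a, ENNReal.ofReal (network W a x ^ 2)
        ∂(Measure.pi fun _ : Fin m => uniformOn ({-1, 1} : Set ℝ))
      ≤ ENNReal.ofReal (1 / m) * ∑ r, ENNReal.ofReal (max 0 (inner ℝ (W r) x) ^ 2) := by
    intro W
    have h := lintegral_sq_sum_pi_le (uniformOn ({-1, 1} : Set ℝ))
      (X := fun r s => 1 / √m * (s * max 0 (inner ℝ (W r) x)))
      (c := fun r => 1 / √m * max 0 (inner ℝ (W r) x)) (fun r => by fun_prop)
      (fun r => by
        filter_upwards [ae_abs_eq_one_uniformOn] with s hs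
        rw [abs_mul, abs_mul, hs, one_mul, abs_of_nonneg (by positivity : (0 : ℝ) ≤ 1 / √m),
          abs_of_nonneg (le_max_left _ _)])
      (fun r => by
        rw [integral_const_mul, integral_mul_const, integral_id_uniformOn, zero_mul, mul_zero])
    simp only [network, Finset.mul_sum]
    refine h.trans (le_of_eq ?_)
    simp only [mul_pow, ← Finset.mul_sum]
    rw [div_pow, Real.sq_sqrt (by positivity), one_pow, ENNReal.ofReal_mul (by positivity),
      ENNReal.ofReal_sum_of_nonneg fun r _ => by positivity]
  refine (lintegral_mono h1).trans ?_
  rw [lintegral_const_mul _ (by fun_prop), lintegral_finsetSum _ (fun r _ => by fun_prop)]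
  have h2 : ∀ r : Fin m, ∫⁻ W, ENNReal.ofReal (max 0 (inner ℝ (W r) x) ^ 2)
      ∂(Measure.pi fun _ : Fin m => stdGaussian (EuclideanSpace ℝ (Fin d))) ≤ 1 := by
    intro r
    refine le_trans (le_of_eq ?_) (lintegral_sq_relu_le hx)
    exact (measurePreserving_eval (fun _ : Fin m => stdGaussian (EuclideanSpace ℝ (Fin d)))
      r).lintegral_comp (f := fun w => ENNReal.ofReal (max 0 (inner ℝ w x) ^ 2)) (by fun_prop)
  calc _ ≤ ENNReal.ofReal (1 / m) * ∑ _r : Fin m, 1 := by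
        gcongr with r _
        exact h2 r
    _ ≤ 1 := by
        rw [← ENNReal.ofReal_one, Finset.sum_const, Finset.card_univ, Fintype.card_fin,
          ← ENNReal.ofReal_nsmul, ← ENNReal.ofReal_mul (by positivity)]
        refine ENNReal.ofReal_le_ofReal ?_
        rcases Nat.eq_zero_or_pos m with rfl | hm
        · simp
        · simp; rw [inv_mul_cancel₀ (by positivity)]

lemma lintegral_sq_norm_residual_le {x : Fin n → EuclideanSpace ℝ (Fin d)} (hx : ∀ i, ‖x i‖ = 1)
    {y : Fin n → ℝ} {B : ℝ} (hy : ∀ i, |y i| ≤ B) :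
    ∫⁻ ω, ENNReal.ofReal (‖residual x y ω.2 ω.1‖ ^ 2) ∂(initMeasure d m)
      ≤ ENNReal.ofReal (n * (2 * (1 + B ^ 2))) := by
  have hpt : ∀ ω : (Fin m → EuclideanSpace ℝ (Fin d)) × (Fin m → ℝ),
      ENNReal.ofReal (‖residual x y ω.2 ω.1‖ ^ 2) ≤
        ∑ i, (ENNReal.ofReal 2 * ENNReal.ofReal (network ω.1 ω.2 (x i) ^ 2)
          + ENNReal.ofReal (2 * B ^ 2)) := by
    intro ω
    rw [EuclideanSpace.real_norm_sq_eq, ENNReal.ofReal_sum_of_nonneg fun i _ => sq_nonneg _]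
    refine Finset.sum_le_sum fun i _ => ?_
    rw [← ENNReal.ofReal_mul (by norm_num), ← ENNReal.ofReal_add (by positivity) (by positivity)]
    refine ENNReal.ofReal_le_ofReal ?_
    have h1 : y i ^ 2 ≤ B ^ 2 := by rw [← sq_abs]; gcongr; exact hy i
    simp only [residual]
    nlinarith [sq_nonneg (network ω.1 ω.2 (x i) + y i)]
  refine (lintegral_mono hpt).trans ?_
  rw [lintegral_finsetSum _ (fun i _ => by fun_prop)]
  calc _ ≤ ∑ _i : Fin n, ENNReal.ofReal (2 * (1 + B ^ 2)) := by
        refine Finset.sum_le_sum fun i _ => ?_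
        rw [lintegral_add_right _ measurable_const, lintegral_const_mul _ (by fun_prop),
          lintegral_const, measure_univ, mul_one, mul_add,
          ENNReal.ofReal_add (by norm_num) (by positivity)]
        gcongr
        rw [ENNReal.ofReal_mul (by norm_num), ENNReal.ofReal_one]
        gcongr
        exact lintegral_sq_network_le (hx i)
    _ = _ := by
        rw [Finset.sum_const, Finset.card_univ, Fintype.card_fin, ← ENNReal.ofReal_nsmul,
          nsmul_eq_mul]

lemma lintegral_fst_initMeasure {f : (Fin m → EuclideanSpace ℝ (Fin d)) → ℝ≥0∞}
    (hf : Measurable f) :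
    ∫⁻ ω, f ω.1 ∂(initMeasure d m) =
      ∫⁻ W, f W ∂(Measure.pi fun _ : Fin m => stdGaussian (EuclideanSpace ℝ (Fin d))) :=
  measurePreserving_fst.lintegral_comp hf

/-- Law of large numbers for the Gram matrix at initialization: its entries have variance at most
`4 / m`. -/
lemma lintegral_sum_sq_gram_sub_le {x : Fin n → EuclideanSpace ℝ (Fin d)}
    (hx : ∀ i, ‖x i‖ = 1) (hm : 0 < m) :
    ∫⁻ ω, ENNReal.ofReal (∑ i, ∑ j, (gram x ω.1 - gramInf x) i j ^ 2) ∂(initMeasure d m)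
      ≤ ENNReal.ofReal (n ^ 2 * (4 / m)) := by
  have hmeas : ∀ i j, Measurable fun W : Fin m → EuclideanSpace ℝ (Fin d) =>
      ENNReal.ofReal ((gram x W - gramInf x) i j ^ 2) := fun i j =>
    (((measurable_gram x i j).sub_const _).pow_const 2).ennreal_ofReal
  have hm' : (m : ℝ) ≠ 0 := by positivity
  have hent : ∀ i j, ∫⁻ ω, ENNReal.ofReal ((gram x ω.1 - gramInf x) i j ^ 2) ∂(initMeasure d m)
      ≤ ENNReal.ofReal (4 / m) := by
    intro i j
    rw [lintegral_fst_initMeasure (hmeas i j)]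
    set g : EuclideanSpace ℝ (Fin d) → ℝ := fun w => inner ℝ (x i) (x j) *
      (if 0 ≤ inner ℝ w (x i) ∧ 0 ≤ inner ℝ w (x j) then 1 else 0) with hg
    have hgm : Measurable g := (measurable_coactivation (x i) (x j)).const_mul _
    have hg1 : ∀ w, |g w| ≤ 1 := fun w => by
      rw [hg, abs_mul]
      exact mul_le_one₀ (abs_inner_le_one (hx i) (hx j)) (abs_nonneg _) (by split_ifs <;> simp)
    have hgint : Integrable g (stdGaussian (EuclideanSpace ℝ (Fin d))) :=
      Integrable.of_bound hgm.aestronglyMeasurable 1 (by filter_upwards with w using hg1 w)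
    have hI : gramInf x i j = ∫ w, g w ∂(stdGaussian (EuclideanSpace ℝ (Fin d))) := rfl
    have hI1 : |gramInf x i j| ≤ 1 := by
      rw [hI]
      simpa using norm_integral_le_of_norm_le_const
        (μ := stdGaussian (EuclideanSpace ℝ (Fin d))) (f := g) (C := 1)
        (by filter_upwards with w using hg1 w)
    have h := lintegral_sq_sum_pi_le (m := m) (stdGaussian (EuclideanSpace ℝ (Fin d)))
      (X := fun _ w => 1 / m * (g w - gramInf x i j)) (c := fun _ => 1 / m * 2)
      (fun r => ((hgm.sub_const _).const_mul _).aestronglyMeasurable)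
      (fun r => by
        filter_upwards with w
        rw [abs_mul, abs_of_nonneg (by positivity : (0 : ℝ) ≤ 1 / m)]
        gcongr
        exact (abs_sub _ _).trans (by linarith [hg1 w]))
      (fun r => by
        rw [integral_const_mul, integral_sub hgint (integrable_const _), ← hI]; simp)
    have heq : ∀ W : Fin m → EuclideanSpace ℝ (Fin d), (gram x W - gramInf x) i j =
        ∑ r, 1 / m * (g (W r) - gramInf x i j) := by
      intro W
      rw [← Finset.mul_sum, Finset.sum_sub_distrib, Matrix.sub_apply, mul_sub]
      simp [gram, hg, hm']
    refine (lintegral_congr fun W => by rw [heq W]).trans_le (h.trans (le_of_eq ?_))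
    congr 1
    simp
    field_simp
    norm_num
  have hpt : ∀ ω : (Fin m → EuclideanSpace ℝ (Fin d)) × (Fin m → ℝ),
      ENNReal.ofReal (∑ i, ∑ j, (gram x ω.1 - gramInf x) i j ^ 2) =
        ∑ i, ∑ j, ENNReal.ofReal ((gram x ω.1 - gramInf x) i j ^ 2) := fun ω =>
    (ENNReal.ofReal_sum_of_nonneg fun i _ => Finset.sum_nonneg fun j _ => sq_nonneg _).trans <|
      Finset.sum_congr rfl fun i _ => ENNReal.ofReal_sum_of_nonneg fun j _ => sq_nonneg _
  rw [lintegral_congr hpt]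
  have hmeas' : ∀ i j, Measurable fun ω : (Fin m → EuclideanSpace ℝ (Fin d)) × (Fin m → ℝ) =>
      ENNReal.ofReal ((gram x ω.1 - gramInf x) i j ^ 2) := fun i j =>
    (hmeas i j).comp measurable_fst
  rw [lintegral_finsetSum _ (fun i _ => Finset.measurable_sum _ fun j _ => hmeas' i j)]
  calc _ ≤ ∑ _i : Fin n, ∑ _j : Fin n, ENNReal.ofReal (4 / m) := by
        refine Finset.sum_le_sum fun i _ => ?_
        rw [lintegral_finsetSum _ (fun j _ => hmeas' i j)]
        exact Finset.sum_le_sum fun j _ => hent i j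
    _ = _ := by
        rw [Finset.sum_const, Finset.sum_const, Finset.card_univ, Fintype.card_fin,
          ← ENNReal.ofReal_nsmul, ← ENNReal.ofReal_nsmul, nsmul_eq_mul, nsmul_eq_mul]
        congr 1; ring

lemma lintegral_sum_nearFrac_le {x : Fin n → EuclideanSpace ℝ (Fin d)}
    (hx : ∀ i, ‖x i‖ = 1) (hm : 0 < m) (R : ℝ) :
    ∫⁻ ω, ENNReal.ofReal (∑ i, nearFrac R ω.1 (x i)) ∂(initMeasure d m)
      ≤ ENNReal.ofReal (n * (2 * R)) := by
  have hmeas : ∀ i, Measurable fun W : Fin m → EuclideanSpace ℝ (Fin d) =>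
      ENNReal.ofReal (nearFrac R W (x i)) := fun i =>
    (measurable_nearFrac R (x i)).ennreal_ofReal
  have hent : ∀ i, ∫⁻ ω, ENNReal.ofReal (nearFrac R ω.1 (x i)) ∂(initMeasure d m)
      ≤ ENNReal.ofReal (2 * R) := by
    intro i
    rw [lintegral_fst_initMeasure (hmeas i)]
    have hset : MeasurableSet {w : EuclideanSpace ℝ (Fin d) | |inner ℝ w (x i)| ≤ R} :=
      measurableSet_le (by fun_prop) measurable_const
    have heq : ∀ W : Fin m → EuclideanSpace ℝ (Fin d), ENNReal.ofReal (nearFrac R W (x i)) =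
        ENNReal.ofReal (1 / m) *
          ∑ r, {w | |inner ℝ w (x i)| ≤ R}.indicator (fun _ => (1 : ℝ≥0∞)) (W r) := by
      intro W
      rw [nearFrac, ENNReal.ofReal_mul (by positivity),
        ENNReal.ofReal_sum_of_nonneg fun r _ => by split_ifs <;> norm_num]
      congr 2
      ext r
      by_cases h : |inner ℝ (W r) (x i)| ≤ R <;> simp [h]
    have hind : Measurable ({w : EuclideanSpace ℝ (Fin d) | |inner ℝ w (x i)| ≤ R}.indicator
        (fun _ => (1 : ℝ≥0∞))) := measurable_const.indicator hset
    simp only [heq]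
    have hind' : ∀ r, Measurable fun W : Fin m → EuclideanSpace ℝ (Fin d) =>
        {w | |inner ℝ w (x i)| ≤ R}.indicator (fun _ => (1 : ℝ≥0∞)) (W r) := fun r =>
      hind.comp (measurable_pi_apply r)
    rw [lintegral_const_mul _ (Finset.measurable_sum _ fun r _ => hind' r),
      lintegral_finsetSum _ (fun r _ => hind' r)]
    calc _ ≤ ENNReal.ofReal (1 / m) * ∑ _r : Fin m, ENNReal.ofReal (2 * R) := by
          gcongr with r _
          rw [(measurePreserving_eval (fun _ : Fin m =>
            stdGaussian (EuclideanSpace ℝ (Fin d))) r).lintegral_comp hind]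
          rw [lintegral_indicator_const hset, one_mul]
          exact stdGaussian_abs_inner_le (hx i) R
      _ = _ := by
          rw [Finset.sum_const, Finset.card_univ, Fintype.card_fin, ← ENNReal.ofReal_nsmul,
            ← ENNReal.ofReal_mul (by positivity), nsmul_eq_mul]
          congr 1
          field_simp
  simp_rw [ENNReal.ofReal_sum_of_nonneg (fun i _ => nearFrac_nonneg _ _ _)]
  have hmeas' : ∀ i, Measurable fun ω : (Fin m → EuclideanSpace ℝ (Fin d)) × (Fin m → ℝ) =>
      ENNReal.ofReal (nearFrac R ω.1 (x i)) := fun i => (hmeas i).comp measurable_fst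
  rw [lintegral_finsetSum _ (fun i _ => hmeas' i)]
  calc _ ≤ ∑ _i : Fin n, ENNReal.ofReal (2 * R) := Finset.sum_le_sum fun i _ => hent i
    _ = _ := by
        rw [Finset.sum_const, Finset.card_univ, Fintype.card_fin, ← ENNReal.ofReal_nsmul,
          nsmul_eq_mul]

/-- Markov's inequality, at the level of failure probability `δ / 3`. -/
lemma measure_three_mul_div_le {Ω : Type*} [MeasurableSpace Ω] (P : Measure Ω) {f : Ω → ℝ}
    (hf : Measurable f) {C δ : ℝ} (hC : 0 < C) (hδ : 0 < δ)
    (h : ∫⁻ ω, ENNReal.ofReal (f ω) ∂P ≤ ENNReal.ofReal C) :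
    P {ω | 3 * C / δ ≤ f ω} ≤ ENNReal.ofReal (δ / 3) := by
  have hpos : 0 < 3 * C / δ := by positivity
  calc P {ω | 3 * C / δ ≤ f ω}
      ≤ P {ω | ENNReal.ofReal (3 * C / δ) ≤ ENNReal.ofReal (f ω)} :=
        measure_mono fun ω hω => ENNReal.ofReal_le_ofReal hω
    _ ≤ (∫⁻ ω, ENNReal.ofReal (f ω) ∂P) / ENNReal.ofReal (3 * C / δ) :=
        meas_ge_le_lintegral_div hf.ennreal_ofReal.aemeasurable (by simpa using hpos)
          ENNReal.ofReal_ne_top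
    _ ≤ ENNReal.ofReal C / ENNReal.ofReal (3 * C / δ) := by gcongr
    _ = ENNReal.ofReal (δ / 3) := by
        rw [← ENNReal.ofReal_div_of_pos hpos]
        congr 1
        field_simp

/-- An event has probability at least `1 - δ` if it contains every initialization at which the
initial residuals, the deviation of the Gram matrix and the fraction of neurons near the activation
boundary are at most `3 / δ` times the bounds on their expectations. It need not be measurable. -/
theorem one_sub_le_initMeasure {x : Fin n → EuclideanSpace ℝ (Fin d)} (hx : ∀ i, ‖x i‖ = 1)
    {y : Fin n → ℝ} {B : ℝ} (hy : ∀ i, |y i| ≤ B) (hn : 0 < n) (hm : 0 < m) {R δ : ℝ}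
    (hR : 0 < R) (hδ : 0 < δ) {G : Set ((Fin m → EuclideanSpace ℝ (Fin d)) × (Fin m → ℝ))}
    (hG : ∀ ω : (Fin m → EuclideanSpace ℝ (Fin d)) × (Fin m → ℝ), (∀ r, |ω.2 r| = 1) →
      ‖residual x y ω.2 ω.1‖ ^ 2 ≤ 3 * (n * (2 * (1 + B ^ 2))) / δ →
      ∑ i, ∑ j, (gram x ω.1 - gramInf x) i j ^ 2 ≤ 3 * (n ^ 2 * (4 / m)) / δ →
      ∑ i, nearFrac R ω.1 (x i) ≤ 3 * (n * (2 * R)) / δ → ω ∈ G) :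
    ENNReal.ofReal (1 - δ) ≤ initMeasure d m G := by
  set P := initMeasure d m
  have hres : Measurable fun ω : (Fin m → EuclideanSpace ℝ (Fin d)) × (Fin m → ℝ) =>
      ‖residual x y ω.2 ω.1‖ ^ 2 := by
    simp only [EuclideanSpace.real_norm_sq_eq, residual]
    fun_prop
  have hgr : Measurable fun ω : (Fin m → EuclideanSpace ℝ (Fin d)) × (Fin m → ℝ) =>
      ∑ i, ∑ j, (gram x ω.1 - gramInf x) i j ^ 2 :=
    Finset.measurable_sum _ fun i _ => Finset.measurable_sum _ fun j _ =>
      (((measurable_gram x i j).comp measurable_fst).sub_const _).pow_const 2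
  have hnf : Measurable fun ω : (Fin m → EuclideanSpace ℝ (Fin d)) × (Fin m → ℝ) =>
      ∑ i, nearFrac R ω.1 (x i) :=
    Finset.measurable_sum _ fun i _ => (measurable_nearFrac R (x i)).comp measurable_fst
  have h0 : P {ω | ¬ ∀ r, |ω.2 r| = 1} = 0 := ae_iff.1 ae_abs_sign_eq_one
  have h1 := measure_three_mul_div_le P hres (by positivity) hδ
    (lintegral_sq_norm_residual_le hx hy)
  have h2 := measure_three_mul_div_le P hgr (by positivity) hδ
    (lintegral_sum_sq_gram_sub_le hx hm)
  have h3 := measure_three_mul_div_le P hnf (by positivity) hδ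
    (lintegral_sum_nearFrac_le hx hm R)
  have hcover : (Set.univ : Set ((Fin m → EuclideanSpace ℝ (Fin d)) × (Fin m → ℝ))) ⊆
      G ∪ ({ω | ¬ ∀ r, |ω.2 r| = 1} ∪ ({ω | 3 * (n * (2 * (1 + B ^ 2))) / δ ≤
        ‖residual x y ω.2 ω.1‖ ^ 2} ∪ ({ω | 3 * (n ^ 2 * (4 / m)) / δ ≤
        ∑ i, ∑ j, (gram x ω.1 - gramInf x) i j ^ 2} ∪ {ω | 3 * (n * (2 * R)) / δ ≤
        ∑ i, nearFrac R ω.1 (x i)}))) := by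
    intro ω _
    by_contra hω
    simp only [Set.mem_union, Set.mem_ofPred_eq, not_or, not_not, not_le] at hω
    exact hω.1 (hG ω hω.2.1 hω.2.2.1.le hω.2.2.2.1.le hω.2.2.2.2.le)
  rw [ENNReal.ofReal_sub _ hδ.le, ENNReal.ofReal_one, tsub_le_iff_right, ← measure_univ (μ := P)]
  refine (measure_mono hcover).trans ((measure_union_le _ _).trans ?_)
  gcongr
  refine (measure_union_le _ _).trans ?_
  rw [h0, zero_add]
  refine (measure_union_le _ _).trans ?_
  refine (add_le_add h1 ((measure_union_le _ _).trans (add_le_add h2 h3))).trans (le_of_eq ?_)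
  rw [← ENNReal.ofReal_add (by positivity) (by positivity),
    ← ENNReal.ofReal_add (by positivity) (by positivity)]
  congr 1
  ring

/-! ### The convergence theorem -/

lemma minEigenvalue_gramInf_le_one {x : Fin n → EuclideanSpace ℝ (Fin d)}
    (hx : ∀ i, ‖x i‖ = 1) (hn : 0 < n) : minEigenvalue (gramInf x) ≤ 1 := by
  have hdiag : ∀ i, gramInf x i i ≤ 1 := by
    intro i
    have h : ∀ w : EuclideanSpace ℝ (Fin d), ‖inner ℝ (x i) (x i) *
        (if 0 ≤ inner ℝ w (x i) ∧ 0 ≤ inner ℝ w (x i) then (1 : ℝ) else 0)‖ ≤ 1 := fun w => by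
      rw [real_inner_self_eq_norm_sq, hx]
      split_ifs <;> simp
    have h2 := norm_integral_le_of_norm_le_const
      (μ := stdGaussian (EuclideanSpace ℝ (Fin d))) (Filter.Eventually.of_forall h)
    rw [probReal_univ, one_mul] at h2
    exact (le_abs_self _).trans h2
  have h1 := card_mul_minEigenvalue_le_trace (isHermitian_gramInf x)
  have h2 : (gramInf x).trace ≤ n := by
    calc (gramInf x).trace = ∑ i, gramInf x i i := rfl
      _ ≤ ∑ _i : Fin n, (1 : ℝ) := Finset.sum_le_sum fun i _ => hdiag i
      _ = n := by simp
  have hn' : (0 : ℝ) < n := by positivity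
  exact le_of_mul_le_mul_left (by linarith) hn'

end TwoLayer

end

theorem theorem1 :
    -- absolute upper constant in `η = Θ(1 / ‖H^∞‖)`
    ∃ c₂ : ℝ, 0 < c₂ ∧
    -- the bound on the labels
    ∀ B : ℝ, 0 < B →
    -- the constant in the condition on the width
    ∃ Cm : ℝ, 0 < Cm ∧
    -- the lower constant in `η = Θ(1 / ‖H^∞‖)`
    ∀ c₁ : ℝ, 0 < c₁ →
    -- the constant in the number of iterations
    ∃ CT : ℝ, 0 < CT ∧
    ∀ (d n m : ℕ) (x : Fin n → EuclideanSpace ℝ (Fin d)) (y : Fin n → ℝ) (lam₀ δ ε η : ℝ),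
      (∀ i, ‖x i‖ = 1) →
      (∀ i, |y i| ≤ B) →
      TwoLayer.minEigenvalue (TwoLayer.gramInf x) = lam₀ →
      0 < lam₀ →
      0 < δ → δ < 1 →
      0 < ε → ε < 1 →
      Cm * ((n : ℝ) ^ 6 / (lam₀ ^ 4 * δ ^ 3)) ≤ (m : ℝ) →
      c₁ / TwoLayer.maxEigenvalue (TwoLayer.gramInf x) ≤ η →
      η ≤ c₂ / TwoLayer.maxEigenvalue (TwoLayer.gramInf x) →
      ENNReal.ofReal (1 - δ) ≤
        TwoLayer.initMeasure d m
          {ω | ∀ T : ℕ,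
            CT * (TwoLayer.maxEigenvalue (TwoLayer.gramInf x) / lam₀) *
                Real.log (2 * n / (ε * δ)) ≤ (T : ℝ) →
            TwoLayer.loss x y ω.2 (TwoLayer.gdIter x y ω.2 η ω.1 T) ≤ ε} := by
  refine ⟨1, one_pos, fun B hB => ?_⟩
  set K : ℝ := 1 + B ^ 2 with hK
  have hK1 : 1 ≤ K := by nlinarith
  refine ⟨221184 * K, by positivity, fun c₁ hc₁ => ?_⟩
  have hlog2 : 0 < Real.log 2 := Real.log_pos one_lt_two
  have hlogK : 0 ≤ Real.log (3 * K / 2) := Real.log_nonneg (by linarith)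
  refine ⟨(1 + Real.log (3 * K / 2) / Real.log 2) / c₁, by positivity, ?_⟩
  intro d n m x y lam δ ε η hx hy hmin hlam hδ hδ1 hε hε1 hm hη₁ hη₂
  set M := TwoLayer.maxEigenvalue (TwoLayer.gramInf x) with hM
  have hH := TwoLayer.isHermitian_gramInf x
  -- For `n = 0` the smallest eigenvalue is `sInf ∅ = 0`, so that `0 < lam` excludes this case.
  have hn : 0 < n := by
    rcases Nat.eq_zero_or_pos n with rfl | h
    · rw [TwoLayer.minEigenvalue, hH.spectrum_real_eq_range_eigenvalues, Set.range_eq_empty,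
        Real.sInf_empty] at hmin
      exact absurd hmin hlam.ne
    · exact h
  have hn1 : (1 : ℝ) ≤ n := by exact_mod_cast hn
  have hlam1 : lam ≤ 1 := hmin ▸ TwoLayer.minEigenvalue_gramInf_le_one hx hn
  have hlamM : lam ≤ M := hmin ▸ (TwoLayer.minEigenvalue_le hH ⟨0, hn⟩).trans
    (TwoLayer.le_maxEigenvalue hH ⟨0, hn⟩)
  have hM0 : 0 < M := hlam.trans_le hlamM
  have hη0 : 0 < η := (by positivity : 0 < c₁ / M).trans_le hη₁
  have hηM : η * M ≤ 1 := (le_div_iff₀ hM0).1 hη₂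
  have hc₁η : c₁ ≤ η * M := (div_le_iff₀ hM0).1 hη₁
  have hηlam : η * lam ≤ 1 := (by gcongr : η * lam ≤ η * M).trans hηM
  have hm0 : (0 : ℝ) < m := lt_of_lt_of_le (by positivity) hm
  have hm' : 221184 * K * n ^ 6 ≤ m * (lam ^ 4 * δ ^ 3) := by
    rwa [← mul_div_assoc, div_le_iff₀ (by positivity)] at hm
  -- `R` is chosen so that Markov's bound `6 n R / δ` on `∑ i, nearFrac R` is `lam / (16 √n)`.
  set R : ℝ := lam * δ / (96 * (n * √n)) with hR
  refine TwoLayer.one_sub_le_initMeasure hx hy hn (by exact_mod_cast hm0) (R := R) (by positivity)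
    hδ ?_
  intro ω ha hres hgram hnear T hT
  set E : ℝ := √(3 * (n * (2 * K)) / δ) with hE
  have hEsq : E ^ 2 = 3 * (n * (2 * K)) / δ := Real.sq_sqrt (by positivity)
  have hgram' : √(∑ i, ∑ j, (TwoLayer.gram x ω.1 - TwoLayer.gramInf x) i j ^ 2) ≤ lam / 8 := by
    refine Real.sqrt_le_iff.2 ⟨by positivity, hgram.trans ?_⟩
    have h1 : 768 * (n : ℝ) ^ 2 ≤ m * (lam ^ 2 * δ) := by
      calc 768 * (n : ℝ) ^ 2 ≤ 221184 * K * n ^ 6 := by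
            have : (n : ℝ) ^ 2 ≤ n ^ 6 := pow_le_pow_right₀ hn1 (by norm_num)
            nlinarith [pow_pos (zero_lt_one.trans_le hn1) 6]
        _ ≤ m * (lam ^ 4 * δ ^ 3) := hm'
        _ ≤ m * (lam ^ 2 * δ ^ 1) := by
            gcongr ?_ * (?_ * ?_)
            · exact pow_le_pow_of_le_one hlam.le hlam1 (by norm_num)
            · exact pow_le_pow_of_le_one hδ.le hδ1.le (by norm_num)
        _ = _ := by rw [pow_one]
    have h2 : 3 * ((n : ℝ) ^ 2 * (4 / m)) / δ = 12 * n ^ 2 / (m * δ) := by field_simp; norm_num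
    rw [h2, div_pow, div_le_div_iff₀ (by positivity) (by norm_num)]
    linarith
  have hnear' : √(n : ℝ) * ∑ i, TwoLayer.nearFrac R ω.1 (x i) ≤ lam / 16 := by
    calc _ ≤ √(n : ℝ) * (3 * (n * (2 * R)) / δ) := by gcongr
      _ = lam / 16 := by rw [hR]; field_simp; norm_num
  have hE' : ‖TwoLayer.residual x y ω.2 ω.1‖ ≤ E := Real.le_sqrt_of_sq_le hres
  -- The width makes the total movement of each neuron at most `R`: after squaring this asks for
  -- `m ≥ 221184 K n⁵ / (lam⁴ δ³)`, which is the origin of the constant `Cm`.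
  have hmove : 2 * √(n : ℝ) / (√m * lam) * E ≤ R := by
    refine le_of_sq_le_sq ?_ (by positivity)
    have h1 : 221184 * K * n ^ 5 ≤ m * (lam ^ 4 * δ ^ 3) :=
      le_trans (by gcongr; norm_num) hm'
    have hL : (2 * √(n : ℝ) / (√m * lam) * E) ^ 2
        = 2 ^ 2 * n * (3 * (n * (2 * K))) / (m * lam ^ 2 * δ) := by
      rw [mul_pow, hEsq, div_pow, mul_pow, mul_pow, Real.sq_sqrt (by positivity),
        Real.sq_sqrt (by positivity), div_mul_div_comm]
    have hRsq : R ^ 2 = (lam * δ) ^ 2 / (96 ^ 2 * (n ^ 2 * n)) := by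
      rw [hR, div_pow, mul_pow 96, mul_pow (n : ℝ), Real.sq_sqrt (by positivity)]
    rw [hL, hRsq, div_le_div_iff₀ (by positivity) (by positivity)]
    linarith
  have hmain := TwoLayer.norm_residual_gdIter_le hx y ha hη0.le hlam hηlam
    (fun v => hmin ▸ TwoLayer.norm_sub_smul_mulVec_le hH hη0.le hηM v) hgram' hnear' hE' hmove T
  rw [TwoLayer.loss_eq]
  set ℓ := Real.log (2 * n / (ε * δ)) with hℓ
  have hεδ : ε * δ ≤ 1 := mul_le_one₀ hε1.le hδ.le hδ1.le
  have hℓ2 : Real.log 2 ≤ ℓ := by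
    refine Real.log_le_log two_pos ((le_div_iff₀ (by positivity)).2 ?_)
    linarith
  -- The constant factors in the final bound are absorbed into the logarithm by `log 2 ≤ ℓ`.
  have hexp : ℓ + Real.log (3 * K / 2) ≤ η * lam * T := by
    calc ℓ + Real.log (3 * K / 2) ≤ ℓ + Real.log (3 * K / 2) * (ℓ / Real.log 2) := by
          gcongr
          exact le_mul_of_one_le_right hlogK ((one_le_div hlog2).2 hℓ2)
      _ = c₁ * lam * ((1 + Real.log (3 * K / 2) / Real.log 2) / c₁ * (1 / lam) * ℓ) := by
          field_simp
      _ ≤ η * M * lam * ((1 + Real.log (3 * K / 2) / Real.log 2) / c₁ * (1 / lam) * ℓ) := by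
          have : 0 ≤ ℓ := hlog2.le.trans hℓ2
          gcongr
      _ = η * lam * ((1 + Real.log (3 * K / 2) / Real.log 2) / c₁ * (M / lam) * ℓ) := by ring
      _ ≤ η * lam * T := by gcongr
  have hdecay : ((1 - η * lam / 2) ^ T) ^ 2 ≤ Real.exp (-(η * lam * T)) := by
    have h1 : 1 - η * lam / 2 ≤ Real.exp (-(η * lam / 2)) := by
      linarith [Real.add_one_le_exp (-(η * lam / 2))]
    calc ((1 - η * lam / 2) ^ T) ^ 2 ≤ (Real.exp (-(η * lam / 2)) ^ T) ^ 2 := by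
          have : 0 ≤ 1 - η * lam / 2 := by linarith
          gcongr
      _ = _ := by
          rw [← pow_mul, ← Real.exp_nat_mul]
          congr 1
          push_cast
          ring
  have hexp' : Real.exp (-(η * lam * T)) ≤ ε * δ / (3 * n * K) := by
    calc Real.exp (-(η * lam * T)) ≤ Real.exp (-(ℓ + Real.log (3 * K / 2))) := by gcongr
      _ = ε * δ / (3 * n * K) := by
          rw [Real.exp_neg, Real.exp_add, Real.exp_log (by positivity),
            Real.exp_log (by positivity)]
          field_simp
  calc 1 / 2 * ‖TwoLayer.residual x y ω.2 (TwoLayer.gdIter x y ω.2 η ω.1 T)‖ ^ 2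
      ≤ 1 / 2 * ((1 - η * lam / 2) ^ T * E) ^ 2 := by gcongr
    _ = ((1 - η * lam / 2) ^ T) ^ 2 * (3 * n * K / δ) := by rw [mul_pow, hEsq]; ring
    _ ≤ ε * δ / (3 * n * K) * (3 * n * K / δ) := by
        gcongr
        exact hdecay.trans hexp'
    _ = ε := by field_simp
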